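/- Let $k$ be a field of characteristic different from $2$ (for example a global field), with separable closure $k_s$ and $\Gamma_k=\mathrm{Gal}(k_s/k)$. Let $\tilde P_\infty,\tilde P_0\in k[x]$ be relatively prime separable polynomials of degree $4$, with homogenizations $P_\infty(w,x),P_0(w,x)$. Let $F\subset\mathbb P^1$ be the set of points $(u:v)$ for which the form $u^2P_\infty(w,x)+v^2P_0(w,x)$ has a multiple root, and let $\infty=(1:0)$. Let $$E'\subset(\mathbb P^1\setminus F)\times(\mathbb P^1)^4$$ be the (reduced) curve of points $((u:v),(w_1:x_1),\dots,(w_4:x_4))$ with $u^2P_\infty(w_i,x_i)+v^2P_0(w_i,x_i)=0$ for all $i$ and $(w_i:x_i)\neq(w_j:x_j)$ for $i\ne j$, on which $S_4$ acts by permuting the $(w_i:x_i)$. Let $\pi:E\to\mathbb P^1$ be the normalization of $\mathbb P^1$ in $E'$, with the extended action of $S_4$. Let $H^1(\Gamma_k,S_4)$ be the set of continuous homomorphisms $\Gamma_k\to S_4$ up to conjugation in $S_4$. For a continuous homomorphism $\varphi:\Gamma_k\to S_4$ let $\pi_\varphi:E_\varphi\to\mathbb P^1$ be the twist of $\pi$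 by $\varphi$, i.e. the $k$-form of $\pi$ which becomes isomorphic to $E$ over $\mathbb P^1_{k_s}$ in such a way that $\sigma\in\Gamma_k$ acts on $E_\varphi$ as the usual action of $\sigma$ on $E$ followed by that of $\varphi(\sigma)$. Let $\varphi_\infty\in H^1(\Gamma_k,S_4)$ be the class of the Galois action on the four roots of $\tilde P_\infty$ in $k_s$. Let $C$ be a nice (smooth, projective, geometrically integral) curve over $k$ such that $C(k)$ is finite and nonempty, and let $\gamma:C\to\mathbb P^1$ be a dominant $k$-morphism, étale above $F$, such that $\gamma(C(k))=\{\infty\}$. Put $C_\varphi=C\times_{\mathbb P^1}E_\varphi$. If the class of $\varphi$ in $H^1(\Gamma_k,S_4)$ is different from $\varphi_\infty$, then $C_\varphi(k)=\emptyset$. -/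

import Mathlib

open CategoryTheory Limits AlgebraicGeometry Polynomial TopologicalSpace

universe u

attribute [local instance] MvPolynomial.gradedAlgebra

noncomputable section

namespace TwistedCover

/-! ### The projective line -/

section ProjectiveSpace

variable (k : Type u) [Field k]

/-- Projective `n`-space over `k`, as `Proj k[T₀, …, Tₙ]`. -/
def PSpace (n : ℕ) : Scheme.{u} :=
  Proj (MvPolynomial.homogeneousSubmodule (Fin (n + 1)) k)

/-- The structure morphism `ℙⁿ → Spec k`. -/
def PSpace.str (n : ℕ) : PSpace k n ⟶ Spec (.of k) :=
  Proj.toSpecZero (MvPolynomial.homogeneousSubmodule (Fin (n + 1)) k) ≫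
    Spec.map (CommRingCat.ofHom
      (algebraMap k (MvPolynomial.homogeneousSubmodule (Fin (n + 1)) k 0)))

instance (n : ℕ) : IsProper (PSpace.str k n) := by
  have h0 : IsScalarTower k (MvPolynomial.homogeneousSubmodule (Fin (n + 1)) k 0)
      (MvPolynomial (Fin (n + 1)) k) := 
    ⟨fun a b c ↦ by
      change (a • (b : MvPolynomial (Fin (n + 1)) k)) * c = a • ((b : MvPolynomial _ k) * c)
      exact smul_mul_assoc _ _ _⟩
  have h1 : Algebra.FiniteType (MvPolynomial.homogeneousSubmodule (Fin (n + 1)) k 0)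
      (MvPolynomial (Fin (n + 1)) k) :=
    Algebra.FiniteType.of_restrictScalars_finiteType k _ _
  have h2 : Function.Surjective
      (algebraMap k (MvPolynomial.homogeneousSubmodule (Fin (n + 1)) k 0)) := by
    rintro ⟨p, hp⟩
    have hp' : p.totalDegree = 0 := by
      have := (MvPolynomial.mem_homogeneousSubmodule 0 p).mp hp
      exact Nat.le_zero.mp this.totalDegree_le
    refine ⟨MvPolynomial.coeff 0 p, Subtype.ext ?_⟩
    exact (MvPolynomial.totalDegree_eq_zero_iff_eq_C.mp hp').symm
  have h3 : IsClosedImmersion (Spec.map (CommRingCat.ofHom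
      (algebraMap k (MvPolynomial.homogeneousSubmodule (Fin (n + 1)) k 0)))) :=
    IsClosedImmersion.spec_of_surjective _ h2
  have h4 : IsProper (Proj.toSpecZero (MvPolynomial.homogeneousSubmodule (Fin (n + 1)) k)) :=
    inferInstance
  have h5 : IsProper (Spec.map (CommRingCat.ofHom
      (algebraMap k (MvPolynomial.homogeneousSubmodule (Fin (n + 1)) k 0)))) := inferInstance
  unfold PSpace.str
  exact MorphismProperty.comp_mem _ _ _ h4 h5

end ProjectiveSpace

variable {k : Type u} [Field k]

variable (k) in
/-- The projective line over `k`. -/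
abbrev P1 : Scheme.{u} := PSpace k 1

/-- The point `(a : b)` of `ℙ¹` with homogeneous coordinates `a`, `b` in an extension field `K`
of `k`, not both zero. -/
def P1.mk {K : Type u} [Field K] [Algebra k K] (a b : K) (h : a ≠ 0 ∨ b ≠ 0) :
    Spec (.of K) ⟶ P1 k :=
  Proj.fromOfGlobalSections (MvPolynomial.homogeneousSubmodule (Fin 2) k)
    ((Scheme.ΓSpecIso (.of K)).inv.hom.comp
      (MvPolynomial.aeval (R := k) ![a, b] : MvPolynomial (Fin 2) k →ₐ[k] K).toRingHom) (by
    have key : ∀ i : Fin 2, (![a, b] i) ≠ 0 →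
        (HomogeneousIdeal.irrelevant (MvPolynomial.homogeneousSubmodule (Fin 2) k)).toIdeal.map
        ((Scheme.ΓSpecIso (.of K)).inv.hom.comp
          (MvPolynomial.aeval (R := k) ![a, b] : MvPolynomial (Fin 2) k →ₐ[k] K).toRingHom)
          = ⊤ := by
      intro i hi
      refine Ideal.eq_top_of_isUnit_mem _
        (Ideal.mem_map_of_mem _ (x := (MvPolynomial.X i : MvPolynomial (Fin 2) k)) ?_) ?_
      · rw [HomogeneousIdeal.mem_iff, HomogeneousIdeal.mem_irrelevant_iff]
        exact GradedRing.proj_apply (MvPolynomial.homogeneousSubmodule (Fin 2) k) 0 _ ▸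
          DirectSum.decompose_of_mem_ne _ (MvPolynomial.isHomogeneous_X k i) one_ne_zero
      · have : IsUnit (![a, b] i) := isUnit_iff_ne_zero.mpr hi
        simpa using this.map (Scheme.ΓSpecIso (.of K)).inv.hom
    rcases h with h | h
    · exact key 0 h
    · exact key 1 h)

/-- The rational point `∞ = (1 : 0)`. -/
def infty : Spec (.of k) ⟶ P1 k := P1.mk (K := k) 1 0 (Or.inl one_ne_zero)

/-! ### Rational points and nice curves -/

/-- The set `X(k)` of rational points of the `k`-scheme `s : X ⟶ Spec k`. -/
def RatPoints {X : Scheme.{u}} (s : X ⟶ Spec (.of k)) : Type u :=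
  {p : Spec (.of k) ⟶ X // p ≫ s = 𝟙 _}

/-- `s : C ⟶ Spec k` is a nice curve: smooth of dimension one, projective and geometrically
integral. -/
structure IsNiceCurve {C : Scheme.{u}} (s : C ⟶ Spec (.of k)) : Prop where
  smooth : SmoothOfRelativeDimension 1 s
  geometricallyIntegral : GeometricallyIntegral s
  projective : ∃ (n : ℕ) (i : C ⟶ PSpace k n), IsClosedImmersion i ∧ i ≫ PSpace.str k n = s

/-! ### The pencil of binary quartic forms -/

variable (k) in
/-- A pair of relatively prime separable polynomials of degree four over `k`. -/
structure QuarticPair where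
  /-- the polynomial `P_∞` -/
  Pinf : k[X]
  /-- the polynomial `P_0` -/
  Pzero : k[X]
  natDegree_inf : Pinf.natDegree = 4
  natDegree_zero : Pzero.natDegree = 4
  separable_inf : Pinf.Separable
  separable_zero : Pzero.Separable
  isCoprime : IsCoprime Pinf Pzero

/-- The binary quartic form `u² P_∞(w, x) + v² P_0(w, x)` over `K`, for `u v : K`. The variable of
index `0` is `x` and the one of index `1` is `w`, so that a polynomial `P(x)` is recovered
from its homogenization `P(w, x)` by setting `w = 1`. -/
def QuarticPair.form (D : QuarticPair k) {K : Type u} [Field K] [Algebra k K] (u v : K) :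
    MvPolynomial (Fin 2) K :=
  MvPolynomial.C (u ^ 2) * (D.Pinf.homogenize 4).map (algebraMap k K) +
    MvPolynomial.C (v ^ 2) * (D.Pzero.homogenize 4).map (algebraMap k K)

/-- A binary form has a multiple root if it is divisible by the square of a nonzero linear form. -/
def HasMultipleRoot {K : Type u} [Field K] (Q : MvPolynomial (Fin 2) K) : Prop :=
  ∃ a b : K, (a ≠ 0 ∨ b ≠ 0) ∧
    (MvPolynomial.C a * MvPolynomial.X 0 + MvPolynomial.C b * MvPolynomial.X 1) ^ 2 ∣ Q

/-- The set `F ⊂ ℙ¹` of the points `(u : v)` such that `u² P_∞ + v² P_0` has a multiple root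
(over some extension field over which `u`, `v` and this root are defined). -/
def QuarticPair.branchLocus (D : QuarticPair k) : Set (P1 k) :=
  {q | ∃ (K : Type u) (_ : Field K) (_ : Algebra k K) (u v : K) (h : u ≠ 0 ∨ v ≠ 0),
    q ∈ Set.range (P1.mk (k := k) u v h) ∧ HasMultipleRoot (D.form u v)}

/-! ### The ambient space `ℙ¹ × (ℙ¹)⁴` -/

variable (k) in
/-- `ℙ¹ × ℙ¹` over `k`. -/
abbrev P1Two : Scheme.{u} := pullback (PSpace.str k 1) (PSpace.str k 1)

variable (k) in
/-- `(ℙ¹)⁴` over `k`. -/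
abbrev P1Four : Scheme.{u} :=
  pullback (pullback.fst _ _ ≫ PSpace.str k 1 : P1Two k ⟶ _)
    (pullback.fst _ _ ≫ PSpace.str k 1 : P1Two k ⟶ _)

variable (k) in
/-- `ℙ¹ × (ℙ¹)⁴` over `k`. -/
abbrev Amb : Scheme.{u} :=
  pullback (PSpace.str k 1)
    (pullback.fst _ _ ≫ pullback.fst _ _ ≫ PSpace.str k 1 : P1Four k ⟶ _)

variable (k) in
/-- The first projection `ℙ¹ × (ℙ¹)⁴ → ℙ¹`, with coordinates `(u : v)`. -/
def Amb.base : Amb k ⟶ P1 k := pullback.fst _ _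

variable (k) in
/-- The projections `ℙ¹ × (ℙ¹)⁴ → ℙ¹` to the last four factors, with coordinates `(wᵢ : xᵢ)`. -/
def Amb.coord : Fin 4 → (Amb k ⟶ P1 k) :=
  ![pullback.snd _ _ ≫ pullback.fst _ _ ≫ pullback.fst _ _,
    pullback.snd _ _ ≫ pullback.fst _ _ ≫ pullback.snd _ _,
    pullback.snd _ _ ≫ pullback.snd _ _ ≫ pullback.fst _ _,
    pullback.snd _ _ ≫ pullback.snd _ _ ≫ pullback.snd _ _]

lemma Amb.coord_str (i : Fin 4) :
    Amb.coord k i ≫ PSpace.str k 1 = Amb.base k ≫ PSpace.str k 1 := by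
  have h := pullback.condition (f := PSpace.str k 1)
    (g := (pullback.fst _ _ ≫ pullback.fst _ _ ≫ PSpace.str k 1 : P1Four k ⟶ _))
  have h2 := pullback.condition (f := (pullback.fst _ _ ≫ PSpace.str k 1 : P1Two k ⟶ _))
    (g := (pullback.fst _ _ ≫ PSpace.str k 1 : P1Two k ⟶ _))
  have h3 := pullback.condition (f := PSpace.str k 1) (g := PSpace.str k 1)
  fin_cases i
  · simp [Amb.coord, Amb.base, h]
  · simp [Amb.coord, Amb.base, h, h3]
  · simp [Amb.coord, Amb.base, h, h2]
  · simp [Amb.coord, Amb.base, h, h2, ← h3]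

lemma Amb.hom_ext {T : Scheme.{u}} {f g : T ⟶ Amb k} (h : f ≫ Amb.base k = g ≫ Amb.base k)
    (h' : ∀ i, f ≫ Amb.coord k i = g ≫ Amb.coord k i) : f = g := by
  have h0 := h' 0
  have h1 := h' 1
  have h2 := h' 2
  have h3 := h' 3
  simp only [Amb.coord, Matrix.cons_val] at h0 h1 h2 h3
  refine pullback.hom_ext h (pullback.hom_ext (pullback.hom_ext ?_ ?_)
    (pullback.hom_ext ?_ ?_)) <;> simpa

/-- The automorphism of `ℙ¹ × (ℙ¹)⁴` given by permuting the last four coordinates: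
`τ · (p₀, …, p₃) = (p_{τ⁻¹(0)}, …, p_{τ⁻¹(3)})`, a left action. -/
def Amb.perm (τ : Equiv.Perm (Fin 4)) : Amb k ⟶ Amb k :=
  pullback.lift (Amb.base k)
    (pullback.lift
      (pullback.lift (Amb.coord k (τ⁻¹ 0)) (Amb.coord k (τ⁻¹ 1)) (by simp only [Amb.coord_str]))
      (pullback.lift (Amb.coord k (τ⁻¹ 2)) (Amb.coord k (τ⁻¹ 3)) (by simp only [Amb.coord_str]))
      (by simp [Amb.coord_str, pullback.lift_fst_assoc]))
    (by simp [Amb.coord_str, pullback.lift_fst_assoc])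

@[simp]
lemma Amb.perm_base (τ : Equiv.Perm (Fin 4)) : Amb.perm τ ≫ Amb.base k = Amb.base k := by
  simp [Amb.perm, Amb.base, pullback.lift_fst]

@[simp]
lemma Amb.perm_coord (τ : Equiv.Perm (Fin 4)) (i : Fin 4) :
    Amb.perm τ ≫ Amb.coord k i = Amb.coord k (τ⁻¹ i) := by
  have : Amb.perm τ ≫ pullback.snd _ _ = pullback.lift
      (pullback.lift (Amb.coord k (τ⁻¹ 0)) (Amb.coord k (τ⁻¹ 1)) (by simp only [Amb.coord_str]))
      (pullback.lift (Amb.coord k (τ⁻¹ 2)) (Amb.coord k (τ⁻¹ 3)) (by simp only [Amb.coord_str]))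
      (by simp [Amb.coord_str, pullback.lift_fst_assoc]) := pullback.lift_snd _ _ _
  fin_cases i
  all_goals
    simp [Amb.coord, reassoc_of% this, pullback.lift_fst, pullback.lift_fst_assoc, pullback.lift_snd,
      pullback.lift_snd_assoc]

lemma Amb.perm_perm_inv (τ : Equiv.Perm (Fin 4)) :
    Amb.perm (k := k) τ ≫ Amb.perm τ⁻¹ = 𝟙 _ :=
  Amb.hom_ext (by simp) (by simp)

/-! ### The curve `E'` and the cover `E → ℙ¹` -/

namespace QuarticPair

variable (D : QuarticPair k)

/-- The (locally closed) set of the points `((u : v), (w₁ : x₁), …, (w₄ : x₄))` of `ℙ¹ × (ℙ¹)⁴`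
with `(u : v) ∉ F`, `u² P_∞(wᵢ, xᵢ) + v² P_0(wᵢ, xᵢ) = 0` for all `i`, and
`(wᵢ : xᵢ) ≠ (wⱼ : xⱼ)` for `i ≠ j`. -/
def locus : Set (Amb k) :=
  {z | Amb.base k z ∉ D.branchLocus ∧
    ∃ (K : Type u) (_ : Field K) (_ : Algebra k K) (p : Spec (.of K) ⟶ Amb k)
      (u v : K) (h : u ≠ 0 ∨ v ≠ 0) (w x : Fin 4 → K) (h' : ∀ i, w i ≠ 0 ∨ x i ≠ 0),
      z ∈ Set.range p ∧
      p ≫ Amb.base k = P1.mk u v h ∧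
      (∀ i, p ≫ Amb.coord k i = P1.mk (w i) (x i) (h' i)) ∧
      (∀ i, MvPolynomial.eval ![x i, w i] (D.form u v) = 0) ∧
      ∀ i j, i ≠ j → w i * x j ≠ w j * x i}

lemma perm_mem_locus (τ : Equiv.Perm (Fin 4)) {z : Amb k} (hz : z ∈ D.locus) :
    Amb.perm τ z ∈ D.locus := by
  obtain ⟨hF, K, _, _, p, u, v, h, w, x, h', ⟨y, rfl⟩, hb, hc, he, hd⟩ := hz
  refine ⟨?_, K, _, _, p ≫ Amb.perm τ, u, v, h, fun i ↦ w (τ⁻¹ i), fun i ↦ x (τ⁻¹ i),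
    fun i ↦ h' _, ⟨y, rfl⟩, by simp [hb], fun i ↦ by simp [hc], fun i ↦ he _,
    fun i j hij ↦ hd _ _ (by simpa using hij)⟩
  rwa [← Scheme.Hom.comp_apply, Amb.perm_base]

/-- The closure of `locus`, as a reduced closed subscheme of `ℙ¹ × (ℙ¹)⁴`. -/
def closureIdeal : (Amb k).IdealSheafData :=
  Scheme.IdealSheafData.vanishingIdeal ⟨closure D.locus, isClosed_closure⟩

/-- The permutation action on the closure of `locus`. -/
def permClosure (τ : Equiv.Perm (Fin 4)) :
    D.closureIdeal.subscheme ⟶ D.closureIdeal.subscheme :=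
  Scheme.IdealSheafData.subschemeMap _ _ (Amb.perm τ) (by
    unfold closureIdeal
    rw [Scheme.IdealSheafData.map_vanishingIdeal]
    refine Scheme.IdealSheafData.vanishingIdeal_antimono ?_
    refine closure_minimal ?_ isClosed_closure
    rintro _ ⟨z, hz, rfl⟩
    exact map_mem_closure (Amb.perm τ).continuous hz fun z hz ↦ D.perm_mem_locus τ hz)

@[simp]
lemma permClosure_ι (τ : Equiv.Perm (Fin 4)) :
    D.permClosure τ ≫ D.closureIdeal.subschemeι = D.closureIdeal.subschemeι ≫ Amb.perm τ :=
  Scheme.IdealSheafData.subschemeMap_subschemeι ..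

lemma permClosure_inv (τ : Equiv.Perm (Fin 4)) : D.permClosure τ ≫ D.permClosure τ⁻¹ = 𝟙 _ := by
  rw [← cancel_mono D.closureIdeal.subschemeι, Category.assoc, permClosure_ι,
    ← Category.assoc, permClosure_ι, Category.assoc, Amb.perm_perm_inv]
  simp

/-- `E'` as an open subset of the closure of `locus` (the set `locus` is open in its closure). -/
def opens : D.closureIdeal.subscheme.Opens :=
  Opens.interior (D.closureIdeal.subschemeι ⁻¹' D.locus)

lemma mem_interior_of_inverse {X : Type*} [TopologicalSpace X] {f g : X → X} (hg : Continuous g)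
    (hfg : ∀ z, f (g z) = z) (hgf : ∀ z, g (f z) = z) {A : Set X} (hA : ∀ z ∈ A, f z ∈ A) {y : X}
    (hy : y ∈ interior A) : f y ∈ interior A := by
  have h : g ⁻¹' interior A ⊆ interior A := by
    refine interior_maximal (fun z hz ↦ ?_) (isOpen_interior.preimage hg)
    simpa [hfg] using hA _ (interior_subset hz)
  exact h (by simpa [hgf] using hy)

lemma permClosure_mem (τ : Equiv.Perm (Fin 4)) (z : D.closureIdeal.subscheme)
    (hz : D.closureIdeal.subschemeι z ∈ D.locus) :
    D.closureIdeal.subschemeι (D.permClosure τ z) ∈ D.locus := by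
  have h := D.perm_mem_locus τ hz
  rwa [← Scheme.Hom.comp_apply, ← permClosure_ι, Scheme.Hom.comp_apply] at h

lemma permClosure_inv_apply (τ : Equiv.Perm (Fin 4)) (z : D.closureIdeal.subscheme) :
    D.permClosure τ⁻¹ (D.permClosure τ z) = z := by
  rw [← Scheme.Hom.comp_apply, permClosure_inv]
  rfl

lemma opens_le (τ : Equiv.Perm (Fin 4)) : D.opens ≤ D.permClosure τ ⁻¹ᵁ D.opens :=
  fun _ hy ↦ mem_interior_of_inverse (D.permClosure τ⁻¹).continuous
    (fun z ↦ by simpa using D.permClosure_inv_apply τ⁻¹ z) (D.permClosure_inv_apply τ)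
    (D.permClosure_mem τ) hy

/-- The curve `E'`: the set `locus` with its reduced induced scheme structure. -/
def E' : Scheme.{u} := D.opens

/-- The inclusion of `E'` into `ℙ¹ × (ℙ¹)⁴`. -/
def E'ι : D.E' ⟶ Amb k := D.opens.ι ≫ D.closureIdeal.subschemeι

/-- The first projection `E' → ℙ¹`. -/
def E'proj : D.E' ⟶ P1 k := D.E'ι ≫ Amb.base k

instance : IsNoetherian D.E' := by
  have h1 : LocallyOfFiniteType (Amb.base k ≫ PSpace.str k 1) := by
    unfold Amb.base; infer_instance
  have h2 : QuasiCompact (Amb.base k ≫ PSpace.str k 1) := by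
    unfold Amb.base; infer_instance
  have h3 : IsLocallyNoetherian (Amb k) :=
    LocallyOfFiniteType.isLocallyNoetherian (Amb.base k ≫ PSpace.str k 1)
  have h4 : CompactSpace (Amb k) :=
    QuasiCompact.compactSpace_of_compactSpace (Amb.base k ≫ PSpace.str k 1)
  have h5 : IsNoetherian (Amb k) := {}
  have h6 : IsLocallyNoetherian D.closureIdeal.subscheme :=
    LocallyOfFiniteType.isLocallyNoetherian D.closureIdeal.subschemeι
  have h7 : IsLocallyNoetherian D.E' := by unfold E'; infer_instance
  have h8 : NoetherianSpace D.E' :=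
    by
    unfold E'
    exact ((D.opens.ι ≫ D.closureIdeal.subschemeι).isEmbedding).isInducing.noetherianSpace
  exact {}

instance : QuasiCompact D.E'proj := inferInstance

instance : QuasiSeparated D.E'proj := inferInstance

/-- The cover `π : E → ℙ¹`: the normalization of `ℙ¹` in `E'`. -/
def E : Scheme.{u} := D.E'proj.normalization

/-- The morphism `π : E → ℙ¹`. -/
def π : D.E ⟶ P1 k := D.E'proj.fromNormalization

instance : IsIntegralHom D.π := inferInstanceAs (IsIntegralHom D.E'proj.fromNormalization)

/-- The inclusion `E' → E`. -/
def toE : D.E' ⟶ D.E := D.E'proj.toNormalization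

lemma toE_π : D.toE ≫ D.π = D.E'proj := Scheme.Hom.toNormalization_fromNormalization _

/-- The action of `S₄` on `E'`, by permuting the coordinates `(wᵢ : xᵢ)`. -/
def permE' (τ : Equiv.Perm (Fin 4)) : D.E' ⟶ D.E' :=
  (D.permClosure τ).resLE D.opens D.opens (D.opens_le τ)

lemma permE'_ι (τ : Equiv.Perm (Fin 4)) : D.permE' τ ≫ D.E'ι = D.E'ι ≫ Amb.perm τ := by
  unfold permE' E'ι E'
  rw [Scheme.Hom.resLE_comp_ι_assoc, permClosure_ι, Category.assoc]

/-- The action of `S₄` on `E` over `ℙ¹` that extends the one on `E'`. -/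
def permE (τ : Equiv.Perm (Fin 4)) : D.E ⟶ D.E :=
  D.E'proj.normalizationDesc (D.permE' τ ≫ D.toE) D.π (by
    rw [Category.assoc, toE_π, E'proj, ← Category.assoc, permE'_ι, Category.assoc, Amb.perm_base])

lemma toE_permE (τ : Equiv.Perm (Fin 4)) : D.toE ≫ D.permE τ = D.permE' τ ≫ D.toE :=
  Scheme.Hom.toNormalization_normalizationDesc ..

@[simp]
lemma permE_π (τ : Equiv.Perm (Fin 4)) : D.permE τ ≫ D.π = D.π :=
  Scheme.Hom.normalizationDesc_comp ..

end QuarticPair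

/-! ### The group `Γ_k` and the set `H¹(Γ_k, S₄)` -/

variable (k) in
/-- The absolute Galois group `Γ_k`. -/
abbrev Γ : Type u := Gal(SeparableClosure k/k)

variable (k) in
/-- Continuous homomorphisms `Γ_k → S₄`, where `S₄` is discrete: continuity of a homomorphism
then means that its kernel is open. -/
def ContHom : Type u := {φ : Γ k →* Equiv.Perm (Fin 4) // IsOpen (φ.ker : Set (Γ k))}

variable (k) in
/-- Two homomorphisms are equivalent if they are conjugate by an element of `S₄`. -/
def conjSetoid : Setoid (ContHom k) where
  r φ ψ := ∃ τ : Equiv.Perm (Fin 4), ∀ σ, ψ.1 σ = τ * φ.1 σ * τ⁻¹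
  iseqv :=
    { refl := fun φ ↦ ⟨1, by simp⟩
      symm := fun ⟨τ, h⟩ ↦ ⟨τ⁻¹, fun σ ↦ by rw [h]; group⟩
      trans := fun ⟨τ, h⟩ ⟨τ', h'⟩ ↦ ⟨τ' * τ, fun σ ↦ by rw [h', h]; group⟩ }

variable (k) in
/-- The set `H¹(Γ_k, S₄)`, for the trivial action of `Γ_k` on `S₄`. -/
def H1 : Type u := Quotient (conjSetoid k)

/-- The class in `H¹(Γ_k, S₄)` of a continuous homomorphism `Γ_k → S₄`. -/
def ContHom.cls (φ : ContHom k) : H1 k := Quotient.mk (conjSetoid k) φ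

namespace QuarticPair

variable (D : QuarticPair k)

/-- The roots of `P_∞` in the separable closure. -/
abbrev roots : Set (SeparableClosure k) := D.Pinf.rootSet (SeparableClosure k)

lemma nonempty_enumeration : Nonempty (Fin 4 ≃ D.roots) := by
  have h : Fintype.card D.roots = 4 := by
    rw [← D.natDegree_inf]
    exact Polynomial.card_rootSet_eq_natDegree D.separable_inf
      (IsSepClosed.splits_codomain _ D.separable_inf)
  exact ⟨(Fintype.equivFinOfCardEq h).symm⟩

/-- The homomorphism `φ : Γ_k → S₄` given by the Galois action on the roots `r₀, …, r₃`
of `P_∞`: it is characterized by `σ(rᵢ) = r_{φ(σ)(i)}`. -/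
def rootsHom (e : Fin 4 ≃ D.roots) : ContHom k :=
  ⟨(Equiv.permCongrHom e.symm).toMonoidHom.comp (MulAction.toPermHom (Γ k) D.roots), by
    have h1 : FiniteDimensional k (IntermediateField.adjoin k D.roots) :=
      IntermediateField.finiteDimensional_adjoin fun x _ ↦ Algebra.IsIntegral.isIntegral x
    refine Subgroup.isOpen_mono (H₁ := (IntermediateField.adjoin k D.roots).fixingSubgroup) ?_
      (IntermediateField.fixingSubgroup_isOpen _)
    intro σ hσ
    rw [MonoidHom.mem_ker]
    ext1 i
    apply e.injective
    apply Subtype.ext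
    have := (IntermediateField.mem_fixingSubgroup_iff _ _).mp hσ (e i)
      (IntermediateField.subset_adjoin _ _ (e i).2)
    simpa using this⟩

lemma rootsHom_apply (e : Fin 4 ≃ D.roots) (σ : Γ k) (i : Fin 4) :
    (e ((D.rootsHom e).1 σ i) : SeparableClosure k) = σ (e i) := by
  simp [rootsHom]

/-- The class `φ_∞ ∈ H¹(Γ_k, S₄)` of the Galois action on the four roots of `P_∞`. -/
def phiInf : H1 k := (D.rootsHom (Classical.choice D.nonempty_enumeration)).cls

/-- The class `φ_∞` does not depend on the enumeration of the roots. -/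
lemma cls_rootsHom (e : Fin 4 ≃ D.roots) : (D.rootsHom e).cls = D.phiInf := by
  refine Quotient.sound ⟨e.trans (Classical.choice D.nonempty_enumeration).symm, fun σ ↦ ?_⟩
  ext1 i
  simp [rootsHom]

end QuarticPair

/-! ### Twists -/

section Twists

/-- The base change of the `k`-scheme `s : X ⟶ Spec k` to the separable closure of `k`. -/
abbrev sepBaseChange {X : Scheme.{u}} (s : X ⟶ Spec (.of k)) : Scheme.{u} :=
  pullback s (Spec.map (CommRingCat.ofHom (algebraMap k (SeparableClosure k))))

/-- The automorphism `id × Spec(σ)` of the base change to the separable closure. -/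
def galAct {X : Scheme.{u}} (s : X ⟶ Spec (.of k)) (σ : Γ k) : sepBaseChange s ⟶ sepBaseChange s :=
  pullback.lift (pullback.fst _ _)
    (pullback.snd _ _ ≫ Spec.map (CommRingCat.ofHom (σ : SeparableClosure k →+* SeparableClosure k)))
    (by
      rw [pullback.condition, Category.assoc, ← Spec.map_comp, ← CommRingCat.ofHom_comp]
      congr 3
      ext x
      simp)

/-- A twist `π_φ : E_φ → ℙ¹` of the cover `π : E → ℙ¹` by `φ : Γ_k → S₄`: a `k`-form of
`π`, that is, a scheme over `ℙ¹` with an isomorphism `Ψ` to `E` over `ℙ¹` and the separable closure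
`k_s`, under which the Galois action on `E_φ ×ₖ k_s` corresponds to that on `E ×ₖ k_s`
twisted by `φ`. On `k_s`-points this says `Ψ(σ(q)) = φ(σ)(σ(Ψ(q)))`, and on schemes
`(id × Spec σ) ∘ Ψ = (φ(σ) × id) ∘ Ψ ∘ (id × Spec σ)`, since `σ` acts on `k_s`-points by
`q ↦ (id × Spec σ)⁻¹ ∘ q ∘ Spec σ`. -/
structure Twist (D : QuarticPair k) (φ : ContHom k) where
  /-- the scheme `E_φ` -/
  scheme : Scheme.{u}
  /-- the morphism `π_φ` -/
  proj : scheme ⟶ P1 k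
  /-- the isomorphism `Ψ` -/
  iso : sepBaseChange (proj ≫ PSpace.str k 1) ≅ sepBaseChange (D.π ≫ PSpace.str k 1)
  iso_snd : iso.hom ≫ pullback.snd _ _ = pullback.snd _ _
  iso_proj : iso.hom ≫ pullback.fst _ _ ≫ D.π = pullback.fst _ _ ≫ proj
  iso_galAct : ∀ σ : Γ k, iso.hom ≫ galAct _ σ =
    galAct _ σ ≫ iso.hom ≫
      pullback.lift (pullback.fst _ _ ≫ D.permE (φ.1 σ)) (pullback.snd _ _)
        (by rw [Category.assoc, ← Category.assoc (D.permE _), D.permE_π, pullback.condition])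

end Twists

/-- The fibre product `C_φ = C ×_{ℙ¹} E_φ`. -/
abbrev Twist.curve {D : QuarticPair k} {φ : ContHom k} (T : Twist D φ) {C : Scheme.{u}}
    (γ : C ⟶ P1 k) : Scheme.{u} := pullback γ T.proj

/-- The structure morphism `C_φ → C → Spec k`. -/
def Twist.curveStr {D : QuarticPair k} {φ : ContHom k} (T : Twist D φ) {C : Scheme.{u}}
    (γ : C ⟶ P1 k) (s : C ⟶ Spec (.of k)) : T.curve γ ⟶ Spec (.of k) :=
  pullback.fst γ T.proj ≫ s

end TwistedCover
end

open TwistedCover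

/-! A rational point of `C_φ` projects to a rational point of `C`, which `γ` sends to `∞`; its other
projection is therefore a rational point of `E_φ` above `∞`. The whole content is that such a point
forces `φ` into the class `φ_∞` (`Twist.cls_eq_phiInf`).

Put t = v/u near `∞`. On `E'` the functions rᵢ = xᵢ/wᵢ satisfy P_∞ + t² P_0 = ℓ ∏ (X - rᵢ), where
the leading coefficient ℓ is invertible on a neighbourhood of `∞`. Hence the rᵢ are integral over
the functions on the base and extend to the normalization `E`, together with this factorization
(`map_pencil_E`) and the rule τ^* rᵢ = r_{τ⁻¹(i)} for τ in S₄ (`permE_appLE_normRoot`). At a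
k_s-point e of `E` above `∞` one has t = 0, so the values rᵢ(e) are the roots of P_∞, pairwise
distinct by separability (`exists_enumeration`).

A rational point of the twist above `∞` gives such an e with e = φ(σ)(σ(e)) for all σ. Evaluating
r_{φ(σ)(i)} on both sides yields r_{φ(σ)(i)}(e) = σ(rᵢ(e)): in the numbering of the roots by e, φ is
exactly the Galois action.

The fibre of `E` above `∞` is never computed. `E` is accessed only through its functions; these
inject into the functions on `E'`, which is reduced, so that identities can be checked there at
field-valued points. -/

noncomputable section

namespace TwistedCover

/-! ### Morphisms to affine schemes and to Proj, described by sections -/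

section Schemes

/-- A morphism from an open subscheme to an affine scheme comes from a ring homomorphism into the
sections over that open subscheme. -/
lemma exists_toSpecΓ_comp {X : Scheme.{u}} (U : X.Opens) {R : CommRingCat.{u}}
    (g : U.toScheme ⟶ Spec R) : ∃ φ : R ⟶ Γ(X, U), g = U.toSpecΓ ≫ Spec.map φ := by
  refine ⟨(Scheme.ΓSpecIso R).inv ≫ g.appTop ≫ U.topIso.hom, ?_⟩
  rw [Scheme.Opens.toSpecΓ, Category.assoc, ← Spec.map_comp]
  simp only [Category.assoc, Iso.hom_inv_id, Category.comp_id]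
  rw [Spec.map_comp, ← Scheme.toSpecΓ_naturality_assoc, toSpecΓ_SpecMap_ΓSpecIso_inv,
    Category.comp_id]

lemma toSpecΓ_comp_injective {X : Scheme.{u}} (U : X.Opens) {R : CommRingCat.{u}}
    {φ ψ : R ⟶ Γ(X, U)} (h : U.toSpecΓ ≫ Spec.map φ = U.toSpecΓ ≫ Spec.map ψ) : φ = ψ := by
  have key (χ : R ⟶ Γ(X, U)) :
      (Scheme.ΓSpecIso R).inv ≫ (U.toSpecΓ ≫ Spec.map χ).appTop ≫ U.topIso.hom = χ := by
    rw [Scheme.Hom.comp_appTop, Category.assoc, ← Scheme.ΓSpecIso_inv_naturality_assoc,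
      Scheme.Opens.toSpecΓ_appTop]
    simp only [Category.assoc, Iso.inv_hom_id, Category.comp_id]
  rw [← key φ, h, key]

lemma isoOfEq_inv_morphismRestrict_ι {X Y : Scheme.{u}} (f : X ⟶ Y) {U : Y.Opens} {V : X.Opens}
    (h : f ⁻¹ᵁ U = V) : (X.isoOfEq h).inv ≫ f ∣_ U ≫ U.ι = V.ι ≫ f := by
  subst h
  simp

/-- The pullback of the fraction s/r is f(s)/f(r), written without a denominator. By construction
the morphism is given over D₊(r) by the degree-zero part of the localized map from A_r to
Γ(X)_{f(r)}. -/
lemma awayToSection_fromOfGlobalSections {σ : Type*} {A : Type u} [CommRing A] [SetLike σ A]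
    [AddSubgroupClass σ A] (𝒜 : ℕ → σ) [GradedRing 𝒜] {X : Scheme.{u}} (f : A →+* Γ(X, ⊤))
    (hf : (HomogeneousIdeal.irrelevant 𝒜).toIdeal.map f = ⊤) {r s : A} {n : ℕ} (hn : 0 < n)
    (hr : r ∈ 𝒜 n) (hs : s ∈ 𝒜 (1 • n)) :
    (Proj.fromOfGlobalSections 𝒜 f hf).appLE (Proj.basicOpen 𝒜 r) (X.basicOpen (f r))
        (Proj.fromOfGlobalSections_preimage_basicOpen 𝒜 f hf hn hr).ge
        (Proj.awayToSection 𝒜 r (HomogeneousLocalization.Away.mk 𝒜 hr 1 s hs)) *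
      X.presheaf.map (homOfLE le_top).op (f r) = X.presheaf.map (homOfLE le_top).op (f s) := by
  have hm : Submonoid.powers r ≤ (Submonoid.powers (f r)).comap f := by
    rw [← Submonoid.map_le_iff_le_comap, Submonoid.map_powers]
  -- `ρ` is the canonical map from Γ(X)_{f(r)} to the sections over the basic open set of f(r). It
  -- extends restriction (`hρ1`), and pullback from D₊(r) factors through it (`hρ2`).
  obtain ⟨ρ, hρ⟩ := exists_toSpecΓ_comp (X.basicOpen (f r))
    ((X.isoOfEq (X.toSpecΓ_preimage_basicOpen (f r))).inv ≫ X.toSpecΓ ∣_ _ ≫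
      (basicOpenIsoSpecAway (f r)).hom)
  have hρ1 : CommRingCat.ofHom (algebraMap Γ(X, ⊤) (Localization.Away (f r))) ≫ ρ =
      X.presheaf.map (homOfLE le_top).op := by
    apply toSpecΓ_comp_injective
    rw [Spec.map_comp, ← Category.assoc, ← hρ, Scheme.Opens.toSpecΓ_SpecMap_presheaf_map_top]
    simp only [Category.assoc, basicOpenIsoSpecAway_hom_SpecMap]
    exact isoOfEq_inv_morphismRestrict_ι _ _
  have hρ2 : Proj.awayToSection 𝒜 r ≫
      (Proj.fromOfGlobalSections 𝒜 f hf).appLE (Proj.basicOpen 𝒜 r) (X.basicOpen (f r))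
        (Proj.fromOfGlobalSections_preimage_basicOpen 𝒜 f hf hn hr).ge =
      CommRingCat.ofHom ((IsLocalization.map (M := .powers r) (T := .powers (f r))
        (Localization.Away (f r)) f hm).comp
          (algebraMap (HomogeneousLocalization.Away 𝒜 r) (Localization.Away r))) ≫ ρ := by
    apply toSpecΓ_comp_injective
    rw [Spec.map_comp, Spec.map_comp, Scheme.Opens.toSpecΓ_SpecMap_appLE_assoc,
      ← Category.assoc (Scheme.Opens.toSpecΓ _), ← hρ,
      Proj.fromOfGlobalSections_resLE _ _ _ hn hr]
    change _ ≫ Proj.basicOpenToSpec 𝒜 r = _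
    rw [← Proj.basicOpenIsoSpec_hom 𝒜 r hr hn, Proj.toBasicOpenOfGlobalSections]
    simp
  have h1 (a : Γ(X, ⊤)) : ρ (algebraMap _ (Localization.Away (f r)) a) =
      X.presheaf.map (homOfLE le_top).op a := congr($hρ1 a)
  have h2 := congr($hρ2 (HomogeneousLocalization.Away.mk 𝒜 hr 1 s hs))
  rw [CommRingCat.comp_apply] at h2
  rw [h2, ← h1, ← h1, CommRingCat.comp_apply, ← map_mul]
  congr 1
  simp [HomogeneousLocalization.algebraMap_apply, HomogeneousLocalization.Away.val_mk,
    Localization.mk_eq_mk', IsLocalization.map_mk']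
  exact IsLocalization.mk'_spec (Localization.Away (f r)) (f s) ⟨f r, _⟩

end Schemes

/-! ### Values of sections at field-valued points -/

section Values

/-- The value of a section over `U` at a point with values in a field `K` that lies in `U`. -/
def valueAt {K : Type u} [Field K] {X : Scheme.{u}} (p : Spec (.of K) ⟶ X) (U : X.Opens)
    (h : ⊤ ≤ p ⁻¹ᵁ U) : Γ(X, U) →+* K :=
  (p.appLE U ⊤ h ≫ (Scheme.ΓSpecIso (.of K)).hom).hom

lemma top_le_preimage {K : Type u} [Field K] {X : Scheme.{u}} {p : Spec (.of K) ⟶ X} {U : X.Opens}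
    {y : Spec (.of K)} (h : p y ∈ U) : ⊤ ≤ p ⁻¹ᵁ U := by
  intro z _
  have : z = y := Subsingleton.elim _ _
  subst this
  exact h

lemma valueAt_congr {K : Type u} [Field K] {X : Scheme.{u}} {p p' : Spec (.of K) ⟶ X}
    (hp : p = p') {U : X.Opens} (h : ⊤ ≤ p ⁻¹ᵁ U) (s : Γ(X, U)) :
    valueAt p U h s = valueAt p' U (hp ▸ h) s := by
  subst hp
  rfl

lemma valueAt_comp {K : Type u} [Field K] {X Y : Scheme.{u}} (p : Spec (.of K) ⟶ X) (f : X ⟶ Y)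
    {U : X.Opens} {V : Y.Opens} (e : U ≤ f ⁻¹ᵁ V) (h : ⊤ ≤ p ⁻¹ᵁ U) (s : Γ(Y, V)) :
    valueAt (p ≫ f) V (h.trans (p.preimage_mono e)) s = valueAt p U h (f.appLE V U e s) := by
  simp only [valueAt, CommRingCat.hom_comp, RingHom.comp_apply]
  rw [← Scheme.Hom.appLE_comp_appLE p f V U ⊤ e h]
  rfl

lemma valueAt_map {K : Type u} [Field K] {X : Scheme.{u}} (p : Spec (.of K) ⟶ X)
    {U V : X.Opens} (e : U ≤ V) (h : ⊤ ≤ p ⁻¹ᵁ U) (s : Γ(X, V)) :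
    valueAt p U h (X.presheaf.map (homOfLE e).op s) =
      valueAt p V (h.trans (p.preimage_mono e)) s := by
  simp only [valueAt, CommRingCat.hom_comp, RingHom.comp_apply]
  rw [← Scheme.Hom.map_appLE p h (homOfLE e).op]
  rfl

lemma valueAt_SpecMap_comp {K L : Type u} [Field K] [Field L] (φ : K →+* L) {X : Scheme.{u}}
    (p : Spec (.of K) ⟶ X) {U : X.Opens} (h : ⊤ ≤ p ⁻¹ᵁ U) (s : Γ(X, U)) :
    valueAt (Spec.map (CommRingCat.ofHom φ) ≫ p) U (fun _ _ ↦ h trivial) s =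
      φ (valueAt p U h s) := by
  simp only [valueAt, CommRingCat.hom_comp, RingHom.comp_apply]
  rw [← Scheme.Hom.appLE_comp_appLE _ p U ⊤ ⊤ h le_rfl]
  have h1 : (Spec.map (CommRingCat.ofHom φ)).appLE ⊤ ⊤ le_rfl =
      (Spec.map (CommRingCat.ofHom φ)).appTop := Scheme.Hom.appLE_eq_app _
  rw [h1]
  exact congr($(Scheme.ΓSpecIso_naturality (CommRingCat.ofHom φ)) (p.appLE U ⊤ h s))

lemma basicOpen_ΓSpecIso_inv_eq_top_iff {K : Type u} [Field K] (c : K) :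
    (Spec (.of K)).basicOpen ((Scheme.ΓSpecIso (.of K)).inv c) = ⊤ ↔ c ≠ 0 := by
  rw [basicOpen_eq_of_affine]
  constructor
  · rintro h rfl
    exact (h.ge (Set.mem_univ (⊥ : PrimeSpectrum K))) (zero_mem _)
  · intro h
    refine top_le_iff.mp fun x _ hx ↦ x.2.ne_top ?_
    exact Ideal.eq_top_of_isUnit_mem _ hx h.isUnit

lemma valueAt_ne_zero_iff {K : Type u} [Field K] {X : Scheme.{u}} (p : Spec (.of K) ⟶ X)
    {U : X.Opens} (h : ⊤ ≤ p ⁻¹ᵁ U) (s : Γ(X, U)) :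
    valueAt p U h s ≠ 0 ↔ ⊤ ≤ p ⁻¹ᵁ X.basicOpen s := by
  have h1 : (Spec (.of K)).basicOpen (p.appLE U ⊤ h s) = p ⁻¹ᵁ X.basicOpen s := by
    rw [Scheme.basicOpen_appLE, top_inf_eq]
  rw [← h1, top_le_iff, ← basicOpen_ΓSpecIso_inv_eq_top_iff]
  simp [valueAt]

lemma valueAt_id_top {K : Type u} [Field K] (h : ⊤ ≤ 𝟙 (Spec (.of K)) ⁻¹ᵁ ⊤)
    (x : Γ(Spec (.of K), ⊤)) :
    valueAt (𝟙 (Spec (.of K))) ⊤ h x = (Scheme.ΓSpecIso (.of K)).hom x := by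
  have h1 : (𝟙 (Spec (.of K)) : _ ⟶ _).appLE ⊤ ⊤ h = 𝟙 _ := by
    rw [Scheme.Hom.appLE, Scheme.Hom.id_app]
    exact (Category.id_comp _).trans ((Spec (.of K)).presheaf.map_id _)
  rw [valueAt, h1, Category.id_comp]

/-- A section of a reduced scheme that has the value zero at a field-valued point above every
point is zero. -/
lemma eq_zero_of_valueAt_eq_zero {X : Scheme.{u}} [IsReduced X] {U : X.Opens} (s : Γ(X, U))
    (H : ∀ z ∈ U, ∃ (K : Type u) (_ : Field K) (q : Spec (.of K) ⟶ X) (h : ⊤ ≤ q ⁻¹ᵁ U),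
      z ∈ Set.range q ∧ valueAt q U h s = 0) : s = 0 := by
  -- On a reduced scheme a section vanishes as soon as its basic open set is empty.
  rw [← basicOpen_eq_bot_iff, eq_bot_iff]
  intro z hz
  obtain ⟨K, _, q, h, ⟨y, rfl⟩, h0⟩ := H z (X.basicOpen_le s hz)
  exact ((valueAt_ne_zero_iff q h s).mpr (top_le_preimage hz) h0).elim

lemma le_preimage_top {X Y : Scheme.{u}} (f : X ⟶ Y) (U : X.Opens) : U ≤ f ⁻¹ᵁ ⊤ :=
  fun _ _ ↦ trivial

/-- The constant functions on an open subset of a `k`-scheme. -/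
def constants {k : Type u} [Field k] {X : Scheme.{u}} (s : X ⟶ Spec (.of k)) (U : X.Opens) :
    k →+* Γ(X, U) :=
  ((Scheme.ΓSpecIso (.of k)).inv ≫ s.appLE ⊤ U (le_preimage_top s U)).hom

lemma valueAt_constants {k K : Type u} [Field k] [Field K] {X : Scheme.{u}}
    (s : X ⟶ Spec (.of k)) (U : X.Opens) (p : Spec (.of K) ⟶ X) (h : ⊤ ≤ p ⁻¹ᵁ U) (φ : k →+* K)
    (hp : p ≫ s = Spec.map (CommRingCat.ofHom φ)) (c : k) :
    valueAt p U h (constants s U c) = φ c := by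
  have h1 : s.appLE ⊤ U (le_preimage_top s U) ≫ p.appLE U ⊤ h =
      (Spec.map (CommRingCat.ofHom φ)).appTop := by
    rw [Scheme.Hom.appLE_comp_appLE, Scheme.Hom.appTop, Scheme.Hom.app_eq_appLE]
    simp only [hp]
    rfl
  have h2 := Scheme.ΓSpecIso_inv_naturality (CommRingCat.ofHom φ)
  have h3 : (Scheme.ΓSpecIso (.of k)).inv ≫ s.appLE ⊤ U (le_preimage_top s U) ≫ p.appLE U ⊤ h ≫
      (Scheme.ΓSpecIso (.of K)).hom = CommRingCat.ofHom φ := by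
    rw [reassoc_of% h1, ← reassoc_of% h2, Iso.inv_hom_id, Category.comp_id]
  exact congr($h3 c)

end Values

/-! ### The affine chart and coordinate of the projective line -/

section ProjectiveLine

variable {k : Type u} [Field k]

variable (k) in
/-- The affine chart of `ℙ¹` where the coordinate of index `0` is invertible. -/
def P1.chart : (P1 k).Opens :=
  Proj.basicOpen (MvPolynomial.homogeneousSubmodule (Fin 2) k) (MvPolynomial.X 0)

variable (k) in
lemma P1.isAffineOpen_chart : IsAffineOpen (P1.chart k) :=
  Proj.isAffineOpen_basicOpen _ _ (MvPolynomial.isHomogeneous_X k (0 : Fin 2)) one_pos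

variable (k) in
/-- The affine coordinate `(a : b) ↦ b / a` on the chart of `ℙ¹`. -/
def P1.affineCoord : Γ(P1 k, P1.chart k) :=
  Proj.awayToSection (MvPolynomial.homogeneousSubmodule (Fin 2) k) (MvPolynomial.X 0)
    (HomogeneousLocalization.Away.mk _ (MvPolynomial.isHomogeneous_X k (0 : Fin 2)) 1
      (MvPolynomial.X 1) (MvPolynomial.isHomogeneous_X k (1 : Fin 2)))

variable {K : Type u} [Field K] [Algebra k K] (a b : K) (h : a ≠ 0 ∨ b ≠ 0)

lemma P1.mk_preimage_chart :
    P1.mk a b h ⁻¹ᵁ P1.chart k = (Spec (.of K)).basicOpen ((Scheme.ΓSpecIso (.of K)).inv a) := by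
  refine (Proj.fromOfGlobalSections_preimage_basicOpen
    (MvPolynomial.homogeneousSubmodule (Fin 2) k) _ _ one_pos
    (MvPolynomial.isHomogeneous_X k (0 : Fin 2))).trans ?_
  rw [RingHom.comp_apply]
  congr 2
  simp

lemma P1.top_le_mk_preimage_chart_iff : ⊤ ≤ P1.mk a b h ⁻¹ᵁ P1.chart k ↔ a ≠ 0 := by
  rw [P1.mk_preimage_chart, top_le_iff, basicOpen_ΓSpecIso_inv_eq_top_iff]

lemma P1.valueAt_affineCoord (h' : ⊤ ≤ P1.mk a b h ⁻¹ᵁ P1.chart k) :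
    valueAt (P1.mk a b h) _ h' (P1.affineCoord k) = b / a := by
  have ha := (P1.top_le_mk_preimage_chart_iff a b h).mp h'
  let f := (Scheme.ΓSpecIso (.of K)).inv.hom.comp
    (MvPolynomial.aeval (R := k) ![a, b] : MvPolynomial (Fin 2) k →ₐ[k] K).toRingHom
  -- The identity of sections given by `awayToSection_fromOfGlobalSections` lives on an open subset
  -- of Spec K; evaluating it at the tautological point turns it into an identity in K.
  have hD : ⊤ ≤ 𝟙 (Spec (.of K)) ⁻¹ᵁ (Spec (.of K)).basicOpen (f (MvPolynomial.X 0)) := by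
    have h0 : f (MvPolynomial.X 0) = (Scheme.ΓSpecIso (.of K)).inv a := by
      change (Scheme.ΓSpecIso (.of K)).inv (MvPolynomial.aeval ![a, b] (MvPolynomial.X 0)) = _
      simp
    rw [h0, (basicOpen_ΓSpecIso_inv_eq_top_iff a).mpr ha]
    exact le_rfl
  have hres (c : MvPolynomial (Fin 2) k) :
      valueAt (𝟙 (Spec (.of K))) _ hD ((Spec (.of K)).presheaf.map (homOfLE le_top).op (f c)) =
        MvPolynomial.aeval ![a, b] c := by
    rw [valueAt_map, valueAt_id_top]
    exact Iso.inv_hom_id_apply (Scheme.ΓSpecIso (.of K)) (MvPolynomial.aeval ![a, b] c)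
  obtain ⟨hf, hmk⟩ : ∃ hf, P1.mk a b h = Proj.fromOfGlobalSections _ f hf := ⟨_, rfl⟩
  have key := congr(valueAt (𝟙 (Spec (.of K))) _ hD
    $(awayToSection_fromOfGlobalSections (MvPolynomial.homogeneousSubmodule (Fin 2) k) f hf
      one_pos (MvPolynomial.isHomogeneous_X k (0 : Fin 2))
      (MvPolynomial.isHomogeneous_X k (1 : Fin 2))))
  rw [map_mul, hres, hres, ← valueAt_comp] at key
  rw [eq_div_iff ha]
  simpa using! key

lemma P1.mk_str : P1.mk a b h ≫ PSpace.str k 1 =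
    Spec.map (CommRingCat.ofHom (algebraMap k K)) := by
  let f := (Scheme.ΓSpecIso (.of K)).inv.hom.comp
    (MvPolynomial.aeval (R := k) ![a, b] : MvPolynomial (Fin 2) k →ₐ[k] K).toRingHom
  obtain ⟨hf, hmk⟩ : ∃ hf, P1.mk a b h = Proj.fromOfGlobalSections _ f hf := ⟨_, rfl⟩
  have : CommRingCat.ofHom (algebraMap k (MvPolynomial.homogeneousSubmodule (Fin 2) k 0)) ≫
      CommRingCat.ofHom (f.comp (algebraMap _ (MvPolynomial (Fin 2) k))) =
      CommRingCat.ofHom (algebraMap k K) ≫ (Scheme.ΓSpecIso (.of K)).inv := by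
    ext c
    change (Scheme.ΓSpecIso (.of K)).inv (MvPolynomial.aeval ![a, b] (MvPolynomial.C c)) = _
    rw [MvPolynomial.aeval_C]
    rfl
  rw [hmk]
  refine (Proj.fromOfGlobalSections_toSpecZero_assoc
    (MvPolynomial.homogeneousSubmodule (Fin 2) k) f hf _).trans ?_
  rw [← Spec.map_comp, this, Spec.map_comp, toSpecΓ_SpecMap_ΓSpecIso_inv_assoc]

end ProjectiveLine

variable {k : Type u} [Field k]

/-! ### The pencil of quartics in the affine coordinate -/

namespace QuarticPair

section Pencil

variable (D : QuarticPair k)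

/-- The polynomial `P_∞ + t² P_0` over a `k`-algebra `c : k →+* R`. -/
def pencil {R : Type*} [CommRing R] (c : k →+* R) (t : R) : R[X] :=
  D.Pinf.map c + C (t ^ 2) * D.Pzero.map c

/-- The coefficient of degree four of `P_∞ + t² P_0`. -/
def lead {R : Type*} [CommRing R] (c : k →+* R) (t : R) : R :=
  c (D.Pinf.coeff 4) + t ^ 2 * c (D.Pzero.coeff 4)

lemma map_pencil {R S : Type*} [CommRing R] [CommRing S] (c : k →+* R) (t : R) (f : R →+* S) :
    (D.pencil c t).map f = D.pencil (f.comp c) (f t) := by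
  simp [pencil, Polynomial.map_map]

lemma map_lead {R S : Type*} [CommRing R] [CommRing S] (c : k →+* R) (t : R) (f : R →+* S) :
    f (D.lead c t) = D.lead (f.comp c) (f t) := by
  simp [lead]

lemma natDegree_pencil_le {R : Type*} [CommRing R] (c : k →+* R) (t : R) :
    (D.pencil c t).natDegree ≤ 4 :=
  natDegree_add_le_of_degree_le (natDegree_map_le.trans D.natDegree_inf.le)
    ((natDegree_C_mul_le _ _).trans (natDegree_map_le.trans D.natDegree_zero.le))

lemma coeff_pencil {R : Type*} [CommRing R] (c : k →+* R) (t : R) :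
    (D.pencil c t).coeff 4 = D.lead c t := by
  simp only [pencil, lead, coeff_add, coeff_C_mul, coeff_map]

/-- The two sides have the same coefficient in degree four, so their difference has degree less than
four, and it vanishes at four distinct points. The leading coefficient may be zero here. -/
lemma pencil_eq_prod {K : Type*} [Field K] (c : k →+* K) (t : K) (x : Fin 4 → K)
    (hx : Function.Injective x) (h0 : ∀ i, (D.pencil c t).eval (x i) = 0) :
    D.pencil c t = C (D.lead c t) * ∏ i, (X - C (x i)) := by
  have hm : (∏ i, (X - C (x i))).Monic := monic_prod_X_sub_C x Finset.univ
  have hd : (∏ i, (X - C (x i))).natDegree = 4 := by simp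
  have hlt : (D.pencil c t - C (D.lead c t) * ∏ i, (X - C (x i))).degree < (4 : ℕ) := by
    rw [degree_lt_iff_coeff_zero]
    intro m hm4
    rcases hm4.eq_or_lt with rfl | h
    · rw [coeff_sub, coeff_C_mul, coeff_pencil]
      have : (∏ i, (X - C (x i))).coeff 4 = 1 := by simpa [Monic, leadingCoeff, hd] using hm
      rw [this]
      ring
    · rw [coeff_sub, coeff_C_mul, coeff_eq_zero_of_natDegree_lt
        ((D.natDegree_pencil_le c t).trans_lt h), coeff_eq_zero_of_natDegree_lt (hd.trans_lt h)]
      ring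
  rw [← sub_eq_zero]
  refine eq_zero_of_degree_lt_of_eval_index_eq_zero (v := x) Finset.univ hx.injOn
    (by simpa using hlt) fun i _ ↦ ?_
  rw [eval_sub, h0, eval_mul, eval_prod, Finset.prod_eq_zero (Finset.mem_univ i) (by simp)]
  simp

variable {K : Type u} [Field K] [Algebra k K]

lemma eval_form {u v w x : K} (hu : u ≠ 0) (hw : w ≠ 0) :
    MvPolynomial.eval ![x, w] (D.form u v) =
      u ^ 2 * w ^ 4 * (D.pencil (algebraMap k K) (v / u)).eval (x / w) := by
  simp only [form, map_add, map_mul, MvPolynomial.eval_C, ← homogenize_map]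
  rw [eval_homogenize (natDegree_map_le.trans D.natDegree_inf.le) _ (by simpa using hw),
    eval_homogenize (natDegree_map_le.trans D.natDegree_zero.le) _ (by simpa using hw)]
  simp only [pencil, eval_add, eval_mul, eval_C, Matrix.cons_val_zero, Matrix.cons_val_one]
  field_simp

lemma eval_homogenize_of_eq_zero (p : K[X]) (n : ℕ) (x : K) :
    MvPolynomial.eval ![x, 0] (p.homogenize n) = p.coeff n * x ^ n := by
  simp only [homogenize, MvPolynomial.eval_sum]
  rw [Finset.sum_eq_single (n, 0)]
  · simp [MvPolynomial.eval_monomial, Finsupp.update_eq_add_single]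
  · rintro ⟨i, j⟩ hij hne
    have hj : j ≠ 0 := by
      rintro rfl
      simp_all
    rw [MvPolynomial.eval_monomial, Finsupp.update_eq_add_single, Finsupp.prod_add_index'] <;>
      simp [pow_add, hj]
  · simp

/-- At w = 0 only the x⁴ term of the form survives. A non-zero leading coefficient thus keeps the
roots (w : x) inside the chart w ≠ 0. -/
lemma weight_ne_zero {u v w x : K} (hu : u ≠ 0) (hwx : w ≠ 0 ∨ x ≠ 0)
    (hl : D.lead (algebraMap k K) (v / u) ≠ 0)
    (h0 : MvPolynomial.eval ![x, w] (D.form u v) = 0) : w ≠ 0 := by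
  rintro rfl
  have hx : x ≠ 0 := hwx.resolve_left (by simp)
  have : u ^ 2 * D.lead (algebraMap k K) (v / u) * x ^ 4 = 0 := by
    rw [← h0]
    simp only [form, map_add, map_mul, MvPolynomial.eval_C, ← homogenize_map,
      eval_homogenize_of_eq_zero, lead, coeff_map]
    field_simp
  simp_all

end Pencil

/-! ### An affine neighbourhood of `∞` in the base -/

section Base

variable (D : QuarticPair k)

/-- The affine open subset of `ℙ¹` where `u ≠ 0` and `u² P_∞(w, x) + v² P_0(w, x)` has a non-zero
coefficient of degree four in `x`. -/
def baseOpen : (P1 k).Opens :=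
  (P1 k).basicOpen (D.lead (constants (PSpace.str k 1) (P1.chart k)) (P1.affineCoord k))

lemma baseOpen_le_chart : D.baseOpen ≤ P1.chart k := Scheme.basicOpen_le _ _

lemma isAffineOpen_baseOpen : IsAffineOpen D.baseOpen := (P1.isAffineOpen_chart k).basicOpen _

/-- The coordinate `v / u` on `baseOpen`. -/
def baseCoord : Γ(P1 k, D.baseOpen) :=
  (P1 k).presheaf.map (homOfLE D.baseOpen_le_chart).op (P1.affineCoord k)

/-- Invertibility allows the pencil to be made monic over `baseOpen`, which gives the integrality of
its roots. -/
lemma isUnit_lead : IsUnit (D.lead (constants (PSpace.str k 1) D.baseOpen) D.baseCoord) := by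
  have h := (P1 k).toRingedSpace.isUnit_res_basicOpen
    (D.lead (constants (PSpace.str k 1) (P1.chart k)) (P1.affineCoord k))
  have h' : D.lead (constants (PSpace.str k 1) D.baseOpen) D.baseCoord =
      ((P1 k).presheaf.map (homOfLE D.baseOpen_le_chart).op).hom
        (D.lead (constants (PSpace.str k 1) (P1.chart k)) (P1.affineCoord k)) := by
    rw [map_lead]
    congr 1
  rw [h']
  exact h

variable {K : Type u} [Field K] [Algebra k K] (u v : K) (h : u ≠ 0 ∨ v ≠ 0)

lemma ne_zero_of_mk_mem_baseOpen (h' : ⊤ ≤ P1.mk (k := k) u v h ⁻¹ᵁ D.baseOpen) :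
    u ≠ 0 ∧ D.lead (algebraMap k K) (v / u) ≠ 0 := by
  have hc := h'.trans ((P1.mk (k := k) u v h).preimage_mono D.baseOpen_le_chart)
  refine ⟨(P1.top_le_mk_preimage_chart_iff (k := k) u v h).mp hc, ?_⟩
  have := (valueAt_ne_zero_iff _ hc _).mpr h'
  rw [map_lead, P1.valueAt_affineCoord] at this
  convert this using 2
  ext c
  exact (valueAt_constants _ _ _ _ _ (P1.mk_str u v h) c).symm

lemma mk_mem_baseOpen (hu : u ≠ 0) (hl : D.lead (algebraMap k K) (v / u) ≠ 0) :
    ⊤ ≤ P1.mk (k := k) u v h ⁻¹ᵁ D.baseOpen := by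
  have hc := (P1.top_le_mk_preimage_chart_iff (k := k) u v h).mpr hu
  refine (valueAt_ne_zero_iff _ hc _).mp ?_
  rw [map_lead, P1.valueAt_affineCoord]
  convert hl using 2
  ext c
  exact valueAt_constants _ _ _ _ _ (P1.mk_str u v h) c

lemma valueAt_baseCoord (h' : ⊤ ≤ P1.mk (k := k) u v h ⁻¹ᵁ D.baseOpen) :
    valueAt (P1.mk u v h) _ h' D.baseCoord = v / u := by
  rw [baseCoord, valueAt_map, P1.valueAt_affineCoord]

end Base

end QuarticPair

/-! ### The root functions on the reduced curve `E'` -/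

lemma isReduced_subscheme_vanishingIdeal {X : Scheme.{u}} (Z : Closeds X) :
    IsReduced (Scheme.IdealSheafData.vanishingIdeal Z).subscheme := by
  have (U : (Scheme.IdealSheafData.vanishingIdeal Z).subschemeCover.openCover.I₀) :
      IsReduced ((Scheme.IdealSheafData.vanishingIdeal Z).subschemeCover.openCover.X U) := by
    change X.affineOpens at U
    have : _root_.IsReduced (Γ(X, U) ⧸ (Scheme.IdealSheafData.vanishingIdeal Z).ideal U) := by
      rw [← Ideal.isRadical_iff_quotient_reduced, Scheme.IdealSheafData.vanishingIdeal_ideal]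
      exact PrimeSpectrum.isRadical_vanishingIdeal _
    exact inferInstanceAs (IsReduced (Spec (.of
      (Γ(X, U) ⧸ (Scheme.IdealSheafData.vanishingIdeal Z).ideal U))))
  exact IsReduced.of_openCover _
    (Scheme.IdealSheafData.vanishingIdeal Z).subschemeCover.openCover

/-- Two field-valued points with the same image have a common refinement. -/
lemma exists_fieldPoint_lift {X Y : Scheme.{u}} (f : X ⟶ Y) {K : Type u} [Field K]
    (p : Spec (.of K) ⟶ Y) (z : X) (hz : f z ∈ Set.range p) :
    ∃ (L : Type u) (_ : Field L) (φ : K →+* L) (q : Spec (.of L) ⟶ X),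
      z ∈ Set.range q ∧ q ≫ f = Spec.map (CommRingCat.ofHom φ) ≫ p := by
  obtain ⟨y, hy⟩ := hz
  -- The field `L` is the residue field of a point of the fibre product lying above both given
  -- points.
  obtain ⟨t, ht, -⟩ := Scheme.Pullback.exists_preimage_pullback (f := f) (g := p) z y hy.symm
  let T := pullback f p
  obtain ⟨φ, hφ⟩ := Spec.map_surjective (T.fromSpecResidueField t ≫ pullback.snd f p)
  refine ⟨T.residueField t, inferInstance, φ.hom, T.fromSpecResidueField t ≫ pullback.fst f p,
    ?_, ?_⟩
  · obtain ⟨s⟩ : Nonempty (Spec (T.residueField t)) := inferInstance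
    refine ⟨s, ?_⟩
    rw [Scheme.Hom.comp_apply, Scheme.fromSpecResidueField_apply]
    exact ht
  · rw [Category.assoc, pullback.condition, ← Category.assoc, ← hφ]
    rfl

namespace QuarticPair

variable (D : QuarticPair k)

instance : IsReduced D.E' := by
  have : IsReduced D.closureIdeal.subscheme := isReduced_subscheme_vanishingIdeal _
  unfold E'
  infer_instance

lemma E'ι_mem_locus (z : D.E') : D.E'ι z ∈ D.locus := by
  have h : (D.opens.ι z) ∈ D.opens := by
    rw [← SetLike.mem_coe, ← Scheme.Opens.range_ι]
    exact ⟨z, rfl⟩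
  exact interior_subset (s := D.closureIdeal.subschemeι ⁻¹' D.locus) h

/-- Every point of `E'` is the image of a field-valued point given by homogeneous coordinates. -/
lemma exists_coordinates (z : D.E') :
    ∃ (K L : Type u) (_ : Field K) (_ : Field L) (_ : Algebra k K) (φ : K →+* L)
      (q : Spec (.of L) ⟶ D.E') (u v : K) (h : u ≠ 0 ∨ v ≠ 0) (w x : Fin 4 → K)
      (h' : ∀ i, w i ≠ 0 ∨ x i ≠ 0), z ∈ Set.range q ∧
      q ≫ D.E'proj = Spec.map (CommRingCat.ofHom φ) ≫ P1.mk u v h ∧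
      (∀ i, q ≫ D.E'ι ≫ Amb.coord k i =
        Spec.map (CommRingCat.ofHom φ) ≫ P1.mk (w i) (x i) (h' i)) ∧
      (∀ i, MvPolynomial.eval ![x i, w i] (D.form u v) = 0) ∧
      ∀ i j, i ≠ j → w i * x j ≠ w j * x i := by
  obtain ⟨-, K, _, _, p, u, v, h, w, x, h', hz, hb, hc, he, hd⟩ := D.E'ι_mem_locus z
  -- The coordinates live in `K`, while the point is lifted to `E'` only over an extension `L`. This
  -- suffices, since `φ` carries polynomial identities from `K` to `L`.
  obtain ⟨L, _, φ, q, hq, hqp⟩ := exists_fieldPoint_lift D.E'ι p z hz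
  refine ⟨K, L, _, _, _, φ, q, u, v, h, w, x, h', hq, ?_, fun i ↦ ?_, he, hd⟩
  · rw [E'proj, reassoc_of% hqp, hb]
  · rw [reassoc_of% hqp, hc]

/-- The preimage of `baseOpen` in `E'`. -/
def coverOpen : D.E'.Opens := D.E'proj ⁻¹ᵁ D.baseOpen

lemma exists_affineCoordinates {z : D.E'} (hz : z ∈ D.coverOpen) :
    ∃ (K L : Type u) (_ : Field K) (_ : Field L) (_ : Algebra k K) (φ : K →+* L)
      (q : Spec (.of L) ⟶ D.E') (u v : K) (h : u ≠ 0 ∨ v ≠ 0) (w x : Fin 4 → K)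
      (h' : ∀ i, w i ≠ 0 ∨ x i ≠ 0) (hb : ⊤ ≤ P1.mk (k := k) u v h ⁻¹ᵁ D.baseOpen),
      z ∈ Set.range q ∧ ⊤ ≤ q ⁻¹ᵁ D.coverOpen ∧
      q ≫ D.E'proj = Spec.map (CommRingCat.ofHom φ) ≫ P1.mk u v h ∧
      (∀ i, q ≫ D.E'ι ≫ Amb.coord k i =
        Spec.map (CommRingCat.ofHom φ) ≫ P1.mk (w i) (x i) (h' i)) ∧
      (∀ i, w i ≠ 0) ∧ Function.Injective (fun i ↦ x i / w i) ∧
      ∀ i, ((D.pencil (constants (PSpace.str k 1) _) D.baseCoord).map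
        (valueAt (P1.mk (k := k) u v h) D.baseOpen hb)).eval (x i / w i) = 0 := by
  obtain ⟨K, L, _, _, _, φ, q, u, v, h, w, x, h', ⟨y, rfl⟩, hb, hc, he, hd⟩ :=
    D.exists_coordinates z
  have hq : ⊤ ≤ q ⁻¹ᵁ D.coverOpen := top_le_preimage hz
  have hy : P1.mk (k := k) u v h (Spec.map (CommRingCat.ofHom φ) y) ∈ D.baseOpen := by
    rw [← Scheme.Hom.comp_apply, ← hb, Scheme.Hom.comp_apply]
    exact hz
  have hV := top_le_preimage hy
  obtain ⟨hu, hl⟩ := D.ne_zero_of_mk_mem_baseOpen u v h hV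
  have hw (i : Fin 4) : w i ≠ 0 := D.weight_ne_zero hu (h' i) hl (he i)
  have hcon : (valueAt (P1.mk (k := k) u v h) D.baseOpen hV).comp
      (constants (PSpace.str k 1) _) = algebraMap k K := by
    ext c
    exact valueAt_constants _ _ _ _ _ (P1.mk_str u v h) c
  refine ⟨K, L, _, _, _, φ, q, u, v, h, w, x, h', hV, ⟨y, rfl⟩, hq, hb, hc, hw, ?_, ?_⟩
  · intro i j hij
    by_contra hne
    have := hd i j hne
    simp only [div_eq_div_iff (hw i) (hw j)] at hij
    exact this (by linear_combination -hij)
  · intro i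
    have := he i
    rw [D.eval_form hu (hw i)] at this
    rw [map_pencil, hcon, valueAt_baseCoord]
    simpa [hu, hw i] using this

lemma coverOpen_le (i : Fin 4) : D.coverOpen ≤ (D.E'ι ≫ Amb.coord k i) ⁻¹ᵁ P1.chart k := by
  intro z hz
  obtain ⟨K, L, _, _, _, φ, q, u, v, h, w, x, h', hV, ⟨y, rfl⟩, hq, hb, hc, hw, -⟩ :=
    D.exists_affineCoordinates hz
  change (D.E'ι ≫ Amb.coord k i) (q y) ∈ P1.chart k
  rw [← Scheme.Hom.comp_apply, hc, Scheme.Hom.comp_apply]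
  exact (P1.top_le_mk_preimage_chart_iff (k := k) _ _ (h' i)).mpr (hw i) trivial

/-- The affine coordinate `xᵢ / wᵢ` on `E'`. -/
def rootCoord (i : Fin 4) : Γ(D.E', D.coverOpen) :=
  (D.E'ι ≫ Amb.coord k i).appLE _ _ (D.coverOpen_le i) (P1.affineCoord k)

/-- The pullback of functions along the projection of `E'`. -/
def coverMap : Γ(P1 k, D.baseOpen) →+* Γ(D.E', D.coverOpen) :=
  (D.E'proj.appLE D.baseOpen D.coverOpen le_rfl).hom

/-- Since `E'` is reduced, the coefficients can be compared at field-valued points. There the xᵢ/wᵢ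
are four distinct roots of the specialized pencil, and `pencil_eq_prod` applies. -/
lemma map_pencil_E' :
    (D.pencil (constants (PSpace.str k 1) _) D.baseCoord).map D.coverMap =
      C (D.coverMap (D.lead (constants (PSpace.str k 1) _) D.baseCoord)) *
        ∏ i, (X - C (D.rootCoord i)) := by
  rw [← sub_eq_zero]
  ext n
  rw [coeff_zero]
  refine eq_zero_of_valueAt_eq_zero (U := D.coverOpen) _ fun z hz ↦ ?_
  obtain ⟨K, L, _, _, _, φ, q, u, v, h, w, x, h', hV, hzq, hq, hb, hc, hw, hinj, h0⟩ :=
    D.exists_affineCoordinates hz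
  refine ⟨L, _, q, hq, hzq, ?_⟩
  have hbase (s : Γ(P1 k, D.baseOpen)) : valueAt q D.coverOpen hq (D.coverMap s) =
      φ (valueAt (P1.mk u v h) D.baseOpen hV s) :=
    (valueAt_comp q D.E'proj (U := D.coverOpen) le_rfl hq s).symm.trans
      ((valueAt_congr hb _ s).trans (valueAt_SpecMap_comp φ _ hV s))
  have hroot (i : Fin 4) : valueAt q D.coverOpen hq (D.rootCoord i) = φ (x i / w i) := by
    have hx := (P1.top_le_mk_preimage_chart_iff (k := k) _ _ (h' i)).mpr (hw i)
    refine (valueAt_comp q _ (D.coverOpen_le i) hq _).symm.trans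
      ((valueAt_congr (hc i) _ _).trans ((valueAt_SpecMap_comp φ _ hx _).trans ?_))
    rw [P1.valueAt_affineCoord]
  have hbase' : (valueAt q D.coverOpen hq).comp D.coverMap =
      φ.comp (valueAt (P1.mk u v h) D.baseOpen hV) := RingHom.ext hbase
  rw [← coeff_map, Polynomial.map_sub, Polynomial.map_map, Polynomial.map_mul,
    Polynomial.map_prod, Polynomial.map_C]
  simp only [Polynomial.map_sub, Polynomial.map_X, Polynomial.map_C, hroot]
  rw [hbase', hbase]
  -- The factorization is established over `K` and then carried to `L` by `φ`.
  rw [← Polynomial.map_map, map_pencil,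
    D.pencil_eq_prod _ _ _ hinj (by simpa [map_pencil] using h0),
    ← map_lead]
  simp [Polynomial.map_prod]

end QuarticPair

/-! ### Sections of a normalization over an affine open set -/

section Normalization

variable {X Y : Scheme.{u}} (f : X ⟶ Y) [QuasiCompact f] [QuasiSeparated f]

lemma preimage_le_toNormalization_preimage (U : Y.Opens) :
    f ⁻¹ᵁ U ≤ f.toNormalization ⁻¹ᵁ f.fromNormalization ⁻¹ᵁ U := by
  simp [← Scheme.Hom.comp_preimage]

/-- Over an affine open U the sections of the normalization are the integral closure of Γ(Y, U) in
Γ(X, f⁻¹U), and the map in question is the inclusion of this subring. The next lemma uses the same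
description to extend integral sections. -/
lemma toNormalization_appLE_injective {U : Y.Opens} (hU : IsAffineOpen U) :
    Function.Injective
      (f.toNormalization.appLE _ _ (preimage_le_toNormalization_preimage f U)) := by
  rw [← f.normalizationObjIso_hom_val hU]
  let := (f.app U).hom.toAlgebra
  have h1 : Function.Injective (f.normalizationObjIso hU).hom :=
    (ConcreteCategory.bijective_of_isIso (f.normalizationObjIso hU).hom).1
  exact (Subtype.val_injective (p := (· ∈ integralClosure Γ(Y, U) Γ(X, f ⁻¹ᵁ U)))).comp h1

lemma exists_toNormalization_appLE_eq {U : Y.Opens} (hU : IsAffineOpen U) {x : Γ(X, f ⁻¹ᵁ U)}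
    (hx : (f.appLE U _ le_rfl).hom.IsIntegralElem x) :
    ∃ y, f.toNormalization.appLE _ _ (preimage_le_toNormalization_preimage f U) y = x := by
  rw [Scheme.Hom.appLE_eq_app] at hx
  let := (f.app U).hom.toAlgebra
  obtain ⟨y, hy⟩ : ∃ y, (f.normalizationObjIso hU).hom y =
      (⟨x, hx⟩ : integralClosure Γ(Y, U) Γ(X, f ⁻¹ᵁ U)) :=
    (ConcreteCategory.bijective_of_isIso (f.normalizationObjIso hU).hom).2 _
  refine ⟨y, ?_⟩
  have h : _ = f.toNormalization.appLE _ _ _ y := congr($(f.normalizationObjIso_hom_val hU) y)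
  exact h.symm.trans (congrArg (integralClosure Γ(Y, U) Γ(X, f ⁻¹ᵁ U)).val hy)

lemma appLE_congr_hom {X Y : Scheme.{u}} {f g : X ⟶ Y} (hfg : f = g) {U : Y.Opens} {V : X.Opens}
    (e : V ≤ f ⁻¹ᵁ U) (s : Γ(Y, U)) : f.appLE U V e s = g.appLE U V (hfg ▸ e) s := by
  subst hfg
  rfl

lemma appLE_comp_apply {X Y Z : Scheme.{u}} (f : X ⟶ Y) (g : Y ⟶ Z) {U : Z.Opens} {V : Y.Opens}
    {W : X.Opens} (e₁ : V ≤ g ⁻¹ᵁ U) (e₂ : W ≤ f ⁻¹ᵁ V) (s : Γ(Z, U)) :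
    f.appLE V W e₂ (g.appLE U V e₁ s) =
      (f ≫ g).appLE U W (e₂.trans (f.preimage_mono e₁)) s := by
  rw [← Scheme.Hom.appLE_comp_appLE f g U V W e₁ e₂]
  rfl

end Normalization

/-! ### Extension of the root functions to `E` -/

namespace QuarticPair

variable (D : QuarticPair k)

/-- The preimage of `baseOpen` in `E`. -/
def normOpen : D.E.Opens := D.π ⁻¹ᵁ D.baseOpen

lemma coverOpen_le_toE : D.coverOpen ≤ D.toE ⁻¹ᵁ D.normOpen :=
  preimage_le_toNormalization_preimage D.E'proj D.baseOpen

lemma toE_appLE_injective :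
    Function.Injective (D.toE.appLE D.normOpen D.coverOpen D.coverOpen_le_toE) :=
  toNormalization_appLE_injective D.E'proj D.isAffineOpen_baseOpen

/-- The pencil divided by its invertible leading coefficient is monic, and by `map_pencil_E'` it
vanishes at each root function. -/
lemma isIntegralElem_rootCoord (i : Fin 4) : D.coverMap.IsIntegralElem (D.rootCoord i) := by
  obtain ⟨c, hc⟩ := D.isUnit_lead.exists_left_inv
  refine ⟨C c * D.pencil (constants (PSpace.str k 1) _) D.baseCoord, ?_, ?_⟩
  · refine monic_of_natDegree_le_of_coeff_eq_one 4
      ((natDegree_C_mul_le _ _).trans (D.natDegree_pencil_le _ _)) ?_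
    rw [coeff_C_mul, coeff_pencil, hc]
  · rw [eval₂_mul, eval₂_eq_eval_map D.coverMap (p := D.pencil _ _), map_pencil_E', eval_mul,
      eval_prod, Finset.prod_eq_zero (Finset.mem_univ i) (by simp)]
    simp

/-- The extension of `rootCoord` to `E`. -/
def normRoot (i : Fin 4) : Γ(D.E, D.normOpen) :=
  (exists_toNormalization_appLE_eq D.E'proj D.isAffineOpen_baseOpen
    (x := D.rootCoord i) (D.isIntegralElem_rootCoord i)).choose

lemma toE_appLE_normRoot (i : Fin 4) :
    D.toE.appLE D.normOpen D.coverOpen D.coverOpen_le_toE (D.normRoot i) = D.rootCoord i :=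
  (exists_toNormalization_appLE_eq D.E'proj D.isAffineOpen_baseOpen
    (x := D.rootCoord i) (D.isIntegralElem_rootCoord i)).choose_spec

/-- The pullback of functions along `π`. -/
def normMap : Γ(P1 k, D.baseOpen) →+* Γ(D.E, D.normOpen) :=
  (D.π.appLE D.baseOpen D.normOpen le_rfl).hom

lemma toE_appLE_normMap (s : Γ(P1 k, D.baseOpen)) :
    D.toE.appLE D.normOpen D.coverOpen D.coverOpen_le_toE (D.normMap s) = D.coverMap s :=
  (appLE_comp_apply _ _ _ _ _).trans (appLE_congr_hom D.toE_π _ s)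

/-- Functions on `normOpen` inject into those on `coverOpen`, where the identity is `map_pencil_E'`.
-/
lemma map_pencil_E :
    (D.pencil (constants (PSpace.str k 1) _) D.baseCoord).map D.normMap =
      C (D.normMap (D.lead (constants (PSpace.str k 1) _) D.baseCoord)) *
        ∏ i, (X - C (D.normRoot i)) := by
  apply Polynomial.map_injective
    (D.toE.appLE D.normOpen D.coverOpen D.coverOpen_le_toE).hom D.toE_appLE_injective
  have h : (D.toE.appLE D.normOpen D.coverOpen D.coverOpen_le_toE).hom.comp D.normMap =
    D.coverMap := RingHom.ext D.toE_appLE_normMap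
  rw [Polynomial.map_map, h, map_pencil_E']
  simp [Polynomial.map_prod, toE_appLE_normMap, toE_appLE_normRoot]

lemma normOpen_le_permE (τ : Equiv.Perm (Fin 4)) : D.normOpen ≤ D.permE τ ⁻¹ᵁ D.normOpen := by
  rw [normOpen, ← Scheme.Hom.comp_preimage, permE_π]

lemma coverOpen_le_permE' (τ : Equiv.Perm (Fin 4)) :
    D.coverOpen ≤ D.permE' τ ⁻¹ᵁ D.coverOpen := by
  have : D.permE' τ ≫ D.E'proj = D.E'proj := by
    rw [E'proj, ← Category.assoc, permE'_ι, Category.assoc, Amb.perm_base]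
  rw [coverOpen, ← Scheme.Hom.comp_preimage, this]

/-- By injectivity this can be checked on `E'`, where τ permutes the coordinates. The inverse comes
from the convention of `Amb.perm`, a left action on points. -/
lemma permE_appLE_normRoot (τ : Equiv.Perm (Fin 4)) (i : Fin 4) :
    (D.permE τ).appLE D.normOpen D.normOpen (D.normOpen_le_permE τ) (D.normRoot i) =
      D.normRoot (τ⁻¹ i) := by
  apply D.toE_appLE_injective
  rw [toE_appLE_normRoot, appLE_comp_apply, appLE_congr_hom (D.toE_permE τ),
    ← appLE_comp_apply _ _ D.coverOpen_le_toE (D.coverOpen_le_permE' τ), toE_appLE_normRoot]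
  refine (appLE_comp_apply _ _ _ _ _).trans (appLE_congr_hom ?_ _ _)
  rw [← Category.assoc, permE'_ι, Category.assoc, Amb.perm_coord]

end QuarticPair

/-! ### The fibre of `E` above `∞` -/

lemma infty_str : infty ≫ PSpace.str k 1 = 𝟙 _ :=
  (P1.mk_str (k := k) (1 : k) 0 _).trans (Spec.map_id _)

namespace QuarticPair

variable (D : QuarticPair k)

lemma lead_inf_ne_zero : D.Pinf.coeff 4 ≠ 0 := by
  rw [← D.natDegree_inf]
  exact leadingCoeff_ne_zero.mpr fun h ↦ by simpa [h] using D.natDegree_inf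

lemma infty_mem_baseOpen : ⊤ ≤ infty ⁻¹ᵁ D.baseOpen :=
  D.mk_mem_baseOpen (K := k) 1 0 _ one_ne_zero (by simpa [lead] using D.lead_inf_ne_zero)

section FiberAtInfinity

variable {K : Type u} [Field K] [Algebra k K] (e : Spec (.of K) ⟶ D.E)
  (he : e ≫ D.π = Spec.map (CommRingCat.ofHom (algebraMap k K)) ≫ infty)

include he

lemma top_le_preimage_normOpen : ⊤ ≤ e ⁻¹ᵁ D.normOpen := by
  rw [normOpen, ← Scheme.Hom.comp_preimage, he]
  exact fun _ _ ↦ D.infty_mem_baseOpen trivial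

/-- This is `map_pencil_E` evaluated at `e`: the coordinate v/u vanishes at `∞`, so the pencil
specializes to P_∞. -/
lemma map_Pinf_eq_prod : D.Pinf.map (algebraMap k K) = C (algebraMap k K (D.Pinf.coeff 4)) *
    ∏ i, (X - C (valueAt e D.normOpen (D.top_le_preimage_normOpen e he) (D.normRoot i))) := by
  have h1 : (valueAt e D.normOpen (D.top_le_preimage_normOpen e he)).comp D.normMap =
      (algebraMap k K).comp (valueAt infty D.baseOpen D.infty_mem_baseOpen) := by
    ext s
    exact (valueAt_comp e D.π le_rfl _ s).symm.trans
      ((valueAt_congr he _ s).trans (valueAt_SpecMap_comp _ _ D.infty_mem_baseOpen s))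
  have h2 : (valueAt infty D.baseOpen D.infty_mem_baseOpen).comp
      (constants (PSpace.str k 1) D.baseOpen) = RingHom.id k := by
    ext c
    exact valueAt_constants _ _ _ _ (RingHom.id k) (infty_str.trans (Spec.map_id _).symm) c
  have h3 : valueAt infty D.baseOpen D.infty_mem_baseOpen D.baseCoord = 0 :=
    (D.valueAt_baseCoord (K := k) 1 0 _ D.infty_mem_baseOpen).trans (by simp)
  have h4 := congr(Polynomial.map (valueAt e D.normOpen (D.top_le_preimage_normOpen e he))
    $(D.map_pencil_E))
  have h5 := RingHom.congr_fun h1 (D.lead (constants (PSpace.str k 1) _) D.baseCoord)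
  rw [RingHom.comp_apply] at h5
  rw [Polynomial.map_map, h1, Polynomial.map_mul, Polynomial.map_C, h5, map_pencil,
    RingHom.comp_assoc, h2, RingHom.comp_apply, RingHom.comp_apply, map_lead, h2, h3] at h4
  simpa [pencil, lead, Polynomial.map_prod] using h4

end FiberAtInfinity

/-- A point of `E` above `∞` with values in the separable closure numbers the roots of `P_∞`. -/
lemma exists_enumeration (e : Spec (.of (SeparableClosure k)) ⟶ D.E)
    (he : e ≫ D.π = Spec.map (CommRingCat.ofHom (algebraMap k (SeparableClosure k))) ≫ infty) :
    ∃ r : Fin 4 ≃ D.roots, ∀ i, (r i : SeparableClosure k) =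
      valueAt e D.normOpen (D.top_le_preimage_normOpen e he) (D.normRoot i) := by
  have h := D.map_Pinf_eq_prod e he
  set r := fun i ↦ valueAt e D.normOpen (D.top_le_preimage_normOpen e he) (D.normRoot i) with hr
  -- A separable product of linear factors has distinct roots, so it does not matter whether `e`
  -- lies in the image of `E'`.
  have hinj : Function.Injective r := by
    have hs := D.separable_inf.map (f := algebraMap k (SeparableClosure k))
    rw [h] at hs
    exact separable_prod_X_sub_C_iff.mp hs.of_mul_right
  have h0 : D.Pinf ≠ 0 := D.separable_inf.ne_zero
  have hroot (y : SeparableClosure k) : y ∈ D.roots ↔ ∃ i, r i = y := by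
    rw [roots, mem_rootSet_of_ne h0, aeval_def, eval₂_eq_eval_map, h, eval_mul, eval_prod]
    simp [D.lead_inf_ne_zero, Finset.prod_eq_zero_iff, sub_eq_zero, eq_comm (b := y), hr]
  refine ⟨Equiv.ofBijective (fun i ↦ ⟨r i, (hroot _).mpr ⟨i, rfl⟩⟩)
    ⟨fun i j hij ↦ hinj congr(Subtype.val $hij), fun y ↦ ?_⟩, fun i ↦ rfl⟩
  obtain ⟨i, hi⟩ := (hroot y).mp y.2
  exact ⟨i, Subtype.ext hi⟩

end QuarticPair

/-! ### Rational points of twists above `∞` -/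

namespace Twist

variable {D : QuarticPair k} {φ : ContHom k} (T : Twist D φ)

/-- The point of the base change to the separable closure given by a rational point. -/
def sepPoint {X : Scheme.{u}} (s : X ⟶ Spec (.of k)) (r : Spec (.of k) ⟶ X) (hr : r ≫ s = 𝟙 _) :
    Spec (.of (SeparableClosure k)) ⟶ sepBaseChange s :=
  pullback.lift (Spec.map (CommRingCat.ofHom (algebraMap k (SeparableClosure k))) ≫ r) (𝟙 _)
    (by rw [Category.assoc, hr, Category.comp_id, Category.id_comp])

/-- This is the Galois invariance of a rational point; it holds because σ fixes k. -/
lemma sepPoint_galAct {X : Scheme.{u}} (s : X ⟶ Spec (.of k)) (r : Spec (.of k) ⟶ X)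
    (hr : r ≫ s = 𝟙 _) (σ : Γ k) : sepPoint s r hr ≫ galAct s σ =
      Spec.map (CommRingCat.ofHom (σ : SeparableClosure k →+* SeparableClosure k)) ≫
        sepPoint s r hr := by
  have hσ : Spec.map (CommRingCat.ofHom (σ : SeparableClosure k →+* SeparableClosure k)) ≫
      Spec.map (CommRingCat.ofHom (algebraMap k (SeparableClosure k))) =
      Spec.map (CommRingCat.ofHom (algebraMap k (SeparableClosure k))) := by
    rw [← Spec.map_comp, ← CommRingCat.ofHom_comp]
    congr 2
    ext x
    simp
  apply pullback.hom_ext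
  · simp [sepPoint, galAct, reassoc_of% hσ, pullback.lift_fst]
  · simp [sepPoint, galAct, pullback.lift_snd, pullback.lift_snd_assoc]

/-- If a twist by `φ` has a rational point above `∞`, then `φ` has the class `φ_∞`. -/
theorem cls_eq_phiInf (r : Spec (.of k) ⟶ T.scheme) (hr : r ≫ T.proj = infty) :
    φ.cls = D.phiInf := by
  have hrs : r ≫ T.proj ≫ PSpace.str k 1 = 𝟙 _ := by rw [reassoc_of% hr, infty_str]
  let q := sepPoint _ r hrs
  let e : Spec (.of (SeparableClosure k)) ⟶ D.E := q ≫ T.iso.hom ≫ pullback.fst _ _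
  have he : e ≫ D.π =
      Spec.map (CommRingCat.ofHom (algebraMap k (SeparableClosure k))) ≫ infty := by
    simp only [e, Category.assoc, T.iso_proj]
    simp [q, sepPoint, hr, pullback.lift_fst_assoc]
  -- Transporting the Galois invariance of `q` through `T.iso` gives e = φ(σ)(σ(e)).
  have hgal (σ : Γ k) : e = Spec.map (CommRingCat.ofHom
      (σ : SeparableClosure k →+* SeparableClosure k)) ≫ e ≫ D.permE (φ.1 σ) := by
    have h := congr(q ≫ $(T.iso_galAct σ) ≫ pullback.fst _ _)
    simp only [Category.assoc, pullback.lift_fst] at h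
    rw [← Category.assoc q (galAct _ σ), sepPoint_galAct] at h
    simpa [galAct, e, q, pullback.lift_fst] using h
  obtain ⟨ρ, hρ⟩ := D.exists_enumeration e he
  -- With the numbering `ρ` determined by `e`, the two homomorphisms are equal, not merely
  -- conjugate.
  rw [← D.cls_rootsHom ρ]
  congr 1
  refine Subtype.ext (MonoidHom.ext fun σ ↦ Equiv.ext fun i ↦ ρ.injective (Subtype.ext ?_))
  have hV := D.top_le_preimage_normOpen e he
  -- The root numbered φ(σ)(i) is the value of its root function at φ(σ)(σ(e)). Pullback by φ(σ)
  -- turns the index back into i, and σ comes out of the value.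
  rw [D.rootsHom_apply, hρ, hρ, valueAt_congr (hgal σ)]
  refine (valueAt_SpecMap_comp _ (e ≫ D.permE (φ.1 σ)) (U := D.normOpen)
    (hV.trans (e.preimage_mono (D.normOpen_le_permE (φ.1 σ)))) _).trans (congrArg σ ?_)
  rw [valueAt_comp e (D.permE (φ.1 σ)) (D.normOpen_le_permE _) hV, D.permE_appLE_normRoot]
  simp

end Twist

end TwistedCover

end

theorem mainTheorem7 {k : Type u} [Field k] (h2 : (2 : k) ≠ 0) (D : QuarticPair k)
    {C : Scheme.{u}} (s : C ⟶ Spec (.of k)) (hC : IsNiceCurve s)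
    (hfin : Finite (RatPoints s)) (hne : Nonempty (RatPoints s))
    (γ : C ⟶ P1 k) (hγs : γ ≫ PSpace.str k 1 = s) (hdom : IsDominant γ)
    (hetale : ∃ U : C.Opens, γ ⁻¹' D.branchLocus ⊆ (U : Set C) ∧ Etale (U.ι ≫ γ))
    (hγ : Set.range (fun c : RatPoints s ↦ c.1 ≫ γ) = {infty})
    (φ : ContHom k) (hφ : φ.cls ≠ D.phiInf) (T : Twist D φ) :
    IsEmpty (RatPoints (T.curveStr γ s)) := by
  refine ⟨fun ⟨q, hq⟩ ↦ hφ (T.cls_eq_phiInf (q ≫ pullback.snd γ T.proj) ?_)⟩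
  rw [Category.assoc, ← pullback.condition, ← Category.assoc]
  -- The component in `C` is a rational point, hence lies above `∞`; by the fibre product condition
  -- so does the component in the twist.
  exact hγ.le ⟨⟨q ≫ pullback.fst γ T.proj, by rwa [Category.assoc]⟩, rfl⟩
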